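/- Let $N \ge 2$ and $d$ be natural numbers, let $s > 0$ be real, and let $\rho \in L^1(\mathbb{R}^d, \mathbb{R}_+)$ with $\int_{\mathbb{R}^d} \rho = N$. Consider the SCE multimarginal optimal transport problem $$\min_{\mathbb{P} \mapsto \rho} \int_{(\mathbb{R}^d)^N} \sum_{1 \le i < j \le N} \frac{1}{|r_i - r_j|^s}\, \mathbb{P}(dr_1, \dots, dr_N),$$ where $\mathbb{P} \mapsto \rho$ means that $\mathbb{P}$ runs over the probability measures on $(\mathbb{R}^d)^N$ that are symmetric (invariant under all permutations of the $N$ copies of $\mathbb{R}^d$) and all of whose $N$ marginals on $\mathbb{R}^d$ are equal to $\rho/N$ (that is, have density $\rho/N$ with respect to Lebesgue measure). The integrand takes the value $+\infty$ when two particles coincide. Theorem (Dissociation at infinity). Let $\mathbb{P}$ be a symmetric minimizer of this problem. Then there exists a radius $R > 0$ such that, with $B_R \subset \mathbb{R}^d$ the ball of radius $R$ centred at the origin, for every pair of distinct indices $i \ne j$ in $\{1, \dots, N\}$, $$\mathbb{P}\big(\{(r_1, \dots, r_N) : r_i \notin B_R \text{ and } r_j \notin B_R\}\big) = 0.$$ In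 particular $\mathbb{P}\big((\mathbb{R}^d \setminus B_R) \times (\mathbb{R}^d \setminus B_R) \times \mathbb{R}^{d(N-2)}\big) = 0$. -/

import Mathlib

open MeasureTheory

noncomputable section

namespace SCE

/-- The Euclidean space `ℝ^d`. -/
abbrev Space (d : ℕ) : Type := EuclideanSpace ℝ (Fin d)

/-- Configurations `(r_1, …, r_N)` of `N` particles in `ℝ^d`. -/
abbrev Config (N d : ℕ) : Type := Fin N → Space d

/-- The Riesz interaction energy `∑_{i < j} 1 / |r_i - r_j|^s` of a configuration, with values in
`[0, ∞]`; for `s > 0` it is `∞` as soon as two particles coincide. -/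
def rieszEnergy {N d : ℕ} (s : ℝ) (r : Config N d) : ENNReal :=
  ∑ i : Fin N, ∑ j ∈ Finset.Ioi i, 1 / ‖r i - r j‖ₑ ^ s

/-- The cost of a measure on configurations: the integral of the Riesz interaction energy. -/
def cost {N d : ℕ} (s : ℝ) (P : Measure (Config N d)) : ENNReal :=
  ∫⁻ r, rieszEnergy s r ∂P

/-- Invariance of a measure on configurations under all permutations of the particles. -/
def IsSymmetric {N d : ℕ} (P : Measure (Config N d)) : Prop :=
  ∀ σ : Equiv.Perm (Fin N), P.map (fun r : Config N d => fun i => r (σ i)) = P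

/-- `P ↦ ρ`: all `N` marginals of `P` on `ℝ^d` are the measure with density `ρ / N`. -/
def HasDensity {N d : ℕ} (P : Measure (Config N d)) (ρ : Space d → ℝ) : Prop :=
  ∀ i : Fin N, P.map (fun r : Config N d => r i) =
    (volume : Measure (Space d)).withDensity (fun x => ENNReal.ofReal (ρ x / (N : ℝ)))

/-- The admissible set of the multimarginal problem: the symmetric probability measures on
`(ℝ^d)^N` all of whose marginals are `ρ / N`. -/
def admissible (N d : ℕ) (ρ : Space d → ℝ) : Set (Measure (Config N d)) :=
  {P | IsProbabilityMeasure P ∧ IsSymmetric P ∧ HasDensity P ρ}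

/-- `P` is a symmetric minimizer of the SCE multimarginal problem with Riesz exponent `s`. -/
def IsSymmetricMinimizer {N d : ℕ} (s : ℝ) (ρ : Space d → ℝ) (P : Measure (Config N d)) : Prop :=
  P ∈ admissible N d ρ ∧ IsMinOn (cost s) (admissible N d ρ) P

end SCE

end

namespace SCE

open scoped ENNReal

variable {N d : ℕ}

/-! Suppose two particles can be found arbitrarily far away together with positive probability. Take
a maximal set `K` of particles that can do so; the others may then be assumed to stay in a fixed
ball, and some `p ∈ K` to be the farthest (`exists_outerMax_ne_zero`). Pick a configuration `a` of
this kind with `‖a p‖ = t`, and another one `b` whose particles in `K` are much farther out, and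
exchange their `p`-th particles. In `a`, the particle `p` pays at least `1 / (2t)^s` to another
particle of `K`. Moved into `b`, it meets the bounded particles at about the same distance `t`, at a
cost differing only by `o(t^{-s})`, while all its other new interactions, and those of `b p` inside
`a`, are negligible. The energy drops (`exchange_energy_lt`).

Performing this exchange on a small fraction of the mass of `P` keeps the marginals and lowers the
cost, which contradicts minimality (`not_exchange_lt`) as soon as the minimal cost is finite
(`cost_ne_top`). The competitor is not symmetric, but averaging over permutations leaves its cost
unchanged (`cost_le`). -/

/-! ### The interaction energy: permutation invariance and splitting off one particle. -/

theorem measurable_rieszEnergy (s : ℝ) :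
    Measurable (rieszEnergy s : Config N d → ℝ≥0∞) := by
  unfold rieszEnergy
  fun_prop

/-- A permutation does not preserve the condition `i < j`; over all ordered pairs, its action is a
mere reindexing of both sums. -/
theorem two_mul_rieszEnergy (s : ℝ) (r : Config N d) :
    2 * rieszEnergy s r = ∑ i, ∑ j, if i = j then 0 else 1 / ‖r i - r j‖ₑ ^ s := by
  have h1 : rieszEnergy s r = ∑ i, ∑ j, if i < j then 1 / ‖r i - r j‖ₑ ^ s else 0 := by
    refine Finset.sum_congr rfl fun i _ => ?_
    rw [← Finset.sum_filter]
    congr 1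
    ext j; simp
  have h2 : rieszEnergy s r = ∑ i, ∑ j, if j < i then 1 / ‖r i - r j‖ₑ ^ s else 0 := by
    rw [h1, Finset.sum_comm]
    refine Finset.sum_congr rfl fun i _ => Finset.sum_congr rfl fun j _ => ?_
    rw [← enorm_neg, neg_sub]
  rw [two_mul]
  nth_rewrite 1 [h1]
  rw [h2]
  simp_rw [← Finset.sum_add_distrib]
  refine Finset.sum_congr rfl fun i _ => Finset.sum_congr rfl fun j _ => ?_
  rcases lt_trichotomy i j with h | h | h
  · simp [h, h.ne, h.le.not_gt]
  · simp [h]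
  · simp [h, h.ne', h.le.not_gt]

theorem rieszEnergy_perm (s : ℝ) (σ : Equiv.Perm (Fin N)) (r : Config N d) :
    rieszEnergy s (fun i => r (σ i)) = rieszEnergy s r := by
  have h : 2 * rieszEnergy s (fun i => r (σ i)) = 2 * rieszEnergy s r := by
    rw [two_mul_rieszEnergy, two_mul_rieszEnergy]
    refine Eq.trans (Finset.sum_congr rfl fun i _ => ?_) (Equiv.sum_comp σ _)
    refine Eq.trans ?_ (Equiv.sum_comp σ _)
    simp
  exact (ENNReal.mul_right_inj (by simp) (by simp)).1 h

/-- The interaction energy of the particles other than the `p`-th one. -/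
noncomputable def restEnergy (s : ℝ) (p : Fin N) (r : Config N d) : ℝ≥0∞ :=
  ∑ i : Fin N, ∑ j ∈ Finset.Ioi i, if i = p ∨ j = p then 0 else 1 / ‖r i - r j‖ₑ ^ s

theorem restEnergy_update (s : ℝ) (p : Fin N) (r : Config N d) (x : Space d) :
    restEnergy s p (Function.update r p x) = restEnergy s p r := by
  refine Finset.sum_congr rfl fun i _ => Finset.sum_congr rfl fun j _ => ?_
  split_ifs with h
  · rfl
  · push Not at h
    rw [Function.update_of_ne h.1, Function.update_of_ne h.2]

theorem rieszEnergy_eq_restEnergy_add (s : ℝ) (p : Fin N) (r : Config N d) :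
    rieszEnergy s r =
      restEnergy s p r + ∑ j ∈ Finset.univ.erase p, 1 / ‖r p - r j‖ₑ ^ s := by
  have h1 : rieszEnergy s r = restEnergy s p r + ∑ i : Fin N, ∑ j ∈ Finset.Ioi i,
      if i = p ∨ j = p then 1 / ‖r i - r j‖ₑ ^ s else 0 := by
    unfold rieszEnergy restEnergy
    simp_rw [← Finset.sum_add_distrib]
    refine Finset.sum_congr rfl fun i _ => Finset.sum_congr rfl fun j _ => ?_
    split_ifs <;> simp
  rw [h1]
  congr 1
  have h2 : ∀ i ∈ Finset.univ.erase p, (∑ j ∈ Finset.Ioi i,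
      if i = p ∨ j = p then 1 / ‖r i - r j‖ₑ ^ s else 0) =
        if i < p then 1 / ‖r p - r i‖ₑ ^ s else 0 := by
    intro i hi
    have hi : i ≠ p := Finset.ne_of_mem_erase hi
    simp only [hi, false_or, Finset.sum_ite_eq', Finset.mem_Ioi]
    rw [← enorm_neg (r i - r p), neg_sub]
  rw [← Finset.add_sum_erase _ _ (Finset.mem_univ p), Finset.sum_congr rfl h2]
  have h3 : (∑ j ∈ Finset.Ioi p, if p = p ∨ j = p then 1 / ‖r p - r j‖ₑ ^ s else 0) =
      ∑ j ∈ Finset.univ.erase p, if p < j then 1 / ‖r p - r j‖ₑ ^ s else 0 := by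
    simp only [true_or, if_true]
    rw [← Finset.sum_filter]
    congr 1
    ext j
    simp only [Finset.mem_Ioi, Finset.mem_filter, Finset.mem_erase, Finset.mem_univ, and_true]
    exact ⟨fun h => ⟨h.ne', h⟩, fun h => h.2⟩
  rw [h3, ← Finset.sum_add_distrib]
  refine Finset.sum_congr rfl fun j hj => ?_
  rcases lt_or_gt_of_ne (Finset.ne_of_mem_erase hj) with h | h
  · simp [h, h.le.not_gt]
  · simp [h, h.le.not_gt]

/-! ### Symmetrization of competitors. -/

/-- The average of a measure on configurations over all permutations of the particles. -/
noncomputable def symmetrization (Q : Measure (Config N d)) : Measure (Config N d) :=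
  (Fintype.card (Equiv.Perm (Fin N)) : ℝ≥0∞)⁻¹ •
    ∑ σ : Equiv.Perm (Fin N), Q.map fun r : Config N d => fun i => r (σ i)

theorem measurable_perm (σ : Equiv.Perm (Fin N)) :
    Measurable fun r : Config N d => fun i => r (σ i) := by
  fun_prop

theorem map_finset_sum {α β ι : Type*} [MeasurableSpace α] [MeasurableSpace β]
    (m : ι → Measure α) (t : Finset ι) {f : α → β} (hf : Measurable f) :
    (∑ i ∈ t, m i).map f = ∑ i ∈ t, (m i).map f := by
  classical
  induction t using Finset.induction_on with
  | empty => simp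
  | insert a t ha ih => rw [Finset.sum_insert ha, Finset.sum_insert ha, Measure.map_add _ _ hf, ih]

theorem isSymmetric_symmetrization (Q : Measure (Config N d)) :
    IsSymmetric (symmetrization Q) := by
  intro τ
  unfold symmetrization
  rw [Measure.map_smul, map_finset_sum _ _ (measurable_perm τ)]
  congr 1
  refine Eq.trans (Finset.sum_congr rfl fun σ _ => ?_) (Equiv.sum_comp (Equiv.mulRight τ) _)
  rw [Measure.map_map (measurable_perm τ) (measurable_perm σ)]
  rfl

theorem card_perm_inv_mul : (Fintype.card (Equiv.Perm (Fin N)) : ℝ≥0∞)⁻¹ *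
    Fintype.card (Equiv.Perm (Fin N)) = 1 :=
  ENNReal.inv_mul_cancel (by simp [Fintype.card_ne_zero]) (by simp)

theorem hasDensity_symmetrization {Q : Measure (Config N d)} {ρ : Space d → ℝ}
    (hQ : HasDensity Q ρ) : HasDensity (symmetrization Q) ρ := by
  intro i
  unfold symmetrization
  rw [Measure.map_smul, map_finset_sum _ _ (measurable_pi_apply i)]
  have h : ∀ σ ∈ (Finset.univ : Finset (Equiv.Perm (Fin N))),
      (Q.map fun r : Config N d => fun i => r (σ i)).map (fun r : Config N d => r i) =
      (volume : Measure (Space d)).withDensity (fun x => ENNReal.ofReal (ρ x / (N : ℝ))) := by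
    intro σ _
    rw [Measure.map_map (measurable_pi_apply i) (measurable_perm σ)]
    exact hQ (σ i)
  rw [Finset.sum_congr rfl h, Finset.sum_const, Finset.card_univ, ← Nat.cast_smul_eq_nsmul ℝ≥0∞,
    smul_smul, card_perm_inv_mul, one_smul]

theorem isProbabilityMeasure_symmetrization (Q : Measure (Config N d)) [IsProbabilityMeasure Q] :
    IsProbabilityMeasure (symmetrization Q) := by
  constructor
  unfold symmetrization
  rw [Measure.smul_apply, Measure.finsetSum_apply]
  have h : ∀ σ ∈ (Finset.univ : Finset (Equiv.Perm (Fin N))),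
      (Q.map fun r : Config N d => fun i => r (σ i)) Set.univ = 1 := by
    intro σ _
    rw [Measure.map_apply (measurable_perm σ) MeasurableSet.univ]
    simp
  rw [Finset.sum_congr rfl h]
  simpa using card_perm_inv_mul (N := N)

theorem cost_symmetrization (s : ℝ) (Q : Measure (Config N d)) :
    cost s (symmetrization Q) = cost s Q := by
  unfold cost symmetrization
  rw [lintegral_smul_measure, lintegral_finsetSum_measure]
  have h : ∀ σ ∈ (Finset.univ : Finset (Equiv.Perm (Fin N))),
      ∫⁻ r, rieszEnergy s r ∂(Q.map fun r : Config N d => fun i => r (σ i)) =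
        ∫⁻ r, rieszEnergy s r ∂Q := by
    intro σ _
    rw [lintegral_map (measurable_rieszEnergy s) (measurable_perm σ)]
    simp_rw [rieszEnergy_perm]
  rw [Finset.sum_congr rfl h, Finset.sum_const, Finset.card_univ, nsmul_eq_mul, smul_eq_mul,
    ← mul_assoc, card_perm_inv_mul, one_mul]

/-- A symmetric minimizer also minimizes among the non-symmetric measures. -/
theorem IsSymmetricMinimizer.cost_le {s : ℝ} {ρ : Space d → ℝ} {P Q : Measure (Config N d)}
    (hP : IsSymmetricMinimizer s ρ P) [IsProbabilityMeasure Q] (hQ : HasDensity Q ρ) :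
    cost s P ≤ cost s Q := by
  rw [← cost_symmetrization s Q]
  exact hP.2 ⟨isProbabilityMeasure_symmetrization Q, isSymmetric_symmetrization Q,
    hasDensity_symmetrization hQ⟩

/-- The total mass can be read off any single marginal, so it need not be computed for competitors
built by subtraction or mixing. -/
theorem HasDensity.isProbabilityMeasure {ρ : Space d → ℝ} {P Q : Measure (Config N d)}
    (i : Fin N) [IsProbabilityMeasure P] (hP : HasDensity P ρ) (hQ : HasDensity Q ρ) :
    IsProbabilityMeasure Q := by
  constructor
  have h := congrArg (fun m => m Set.univ) ((hQ i).trans (hP i).symm)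
  simp only [Measure.map_apply (measurable_pi_apply i) MeasurableSet.univ, Set.preimage_univ,
    measure_univ] at h
  exact h

/-! ### Perturbing a minimizer by exchanging particles. -/

/-- The first configuration, after it has received the `p`-th particle of the second one. -/
noncomputable def exchange (p : Fin N) (q : Config N d × Config N d) : Config N d :=
  Function.update q.1 p (q.2 p)

theorem measurable_exchange (p : Fin N) :
    Measurable (exchange p : Config N d × Config N d → Config N d) := by
  unfold exchange
  refine measurable_pi_iff.2 fun i => ?_
  by_cases h : i = p
  · subst h
    simp only [Function.update_self]
    fun_prop
  · simp only [Function.update_of_ne h]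
    fun_prop

/-- If exchanging the `p`-th particles of any two configurations in sets `A` and `B` lowers the
energy by a fixed positive amount, then `A` or `B` is null for a minimizer of finite cost. -/
theorem IsSymmetricMinimizer.not_exchange_lt {s : ℝ} {ρ : Space d → ℝ}
    {P : Measure (Config N d)} (hP : IsSymmetricMinimizer s ρ P) (hfin : cost s P ≠ ∞)
    (p : Fin N) {A B : Set (Config N d)} (hA : MeasurableSet A) (hB : MeasurableSet B)
    (hPA : P A ≠ 0) (hPB : P B ≠ 0) {η : ℝ≥0∞} (hη : η ≠ 0)
    (h : ∀ a ∈ A, ∀ b ∈ B, rieszEnergy s (exchange p (a, b)) +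
      rieszEnergy s (exchange p (b, a)) + η ≤ rieszEnergy s a + rieszEnergy s b) : False := by
  have hprob : IsProbabilityMeasure P := hP.1.1
  set PA := (P A)⁻¹ • P.restrict A with hPAdef
  set PB := (P B)⁻¹ • P.restrict B with hPBdef
  have hPA' := measure_ne_top P A
  have hPB' := measure_ne_top P B
  have iA : IsProbabilityMeasure PA := ⟨by simp [hPAdef, ENNReal.inv_mul_cancel hPA hPA']⟩
  have iB : IsProbabilityMeasure PB := ⟨by simp [hPBdef, ENNReal.inv_mul_cancel hPB hPB']⟩
  -- `A` and `B` may overlap: with the factor `1/2`, each of `ε • PA` and `ε • PB` uses at most half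
  -- of `P`, so their sum can be subtracted.
  set ε : ℝ≥0∞ := min (P A) (P B) / 2 with hε
  have hε0 : ε ≠ 0 := by simp [hε, hPA, hPB]
  have hhalf : ∀ C : Set (Config N d), P C ≠ 0 → ε ≤ P C / 2 →
      ε • ((P C)⁻¹ • P.restrict C) ≤ (2⁻¹ : ℝ≥0∞) • P := by
    intro C hC hle
    rw [smul_smul]
    refine Measure.le_iff.2 fun t ht => ?_
    rw [Measure.smul_apply, Measure.smul_apply, smul_eq_mul, smul_eq_mul]
    refine mul_le_mul' ?_ (Measure.restrict_apply_le _ _)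
    calc ε * (P C)⁻¹ ≤ P C / 2 * (P C)⁻¹ := by gcongr
      _ = P C * (P C)⁻¹ * 2⁻¹ := by rw [div_eq_mul_inv]; ring
      _ = 2⁻¹ := by rw [ENNReal.mul_inv_cancel hC (measure_ne_top P C), one_mul]
  have hX : ε • PA + ε • PB ≤ P := by
    calc ε • PA + ε • PB ≤ (2⁻¹ : ℝ≥0∞) • P + (2⁻¹ : ℝ≥0∞) • P :=
          add_le_add (hhalf A hPA (ENNReal.div_le_div_right (min_le_left _ _) _))
            (hhalf B hPB (ENNReal.div_le_div_right (min_le_right _ _) _))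
      _ = P := by rw [← add_smul, ENNReal.inv_two_add_inv_two, one_smul]
  have iX : IsFiniteMeasure (ε • PA + ε • PB) := isFiniteMeasure_of_le P hX
  set P0 := P - (ε • PA + ε • PB) with hP0
  have hsum : P0 + (ε • PA + ε • PB) = P := Measure.sub_add_cancel_of_le hX
  set M := PA.prod PB with hM
  -- The removed mass is put back as both outcomes of the exchange, for `a` and `b` drawn
  -- independently from `PA` and `PB`.
  set Q := P0 + (ε • M.map (exchange p) + ε • M.map (fun q => exchange p q.swap)) with hQdef
  have hmeas2 : Measurable fun q : Config N d × Config N d => exchange p q.swap :=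
    (measurable_exchange p).comp measurable_swap
  have hQ : HasDensity Q ρ := by
    intro j
    rw [← hP.1.2.2 j]
    have hj := measurable_pi_apply (X := fun _ : Fin N => Space d) j
    conv_rhs => rw [← hsum]
    rw [hQdef]
    simp only [Measure.map_add _ _ hj, Measure.map_smul]
    congr 1
    have e1 : M.map (fun q => q.1 j) = PA.map (fun r => r j) := by
      rw [show (fun q : Config N d × Config N d => q.1 j) = (fun r => r j) ∘ Prod.fst from rfl,
        ← Measure.map_map hj measurable_fst, hM, Measure.map_fst_prod]
      simp
    have e2 : M.map (fun q => q.2 j) = PB.map (fun r => r j) := by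
      rw [show (fun q : Config N d × Config N d => q.2 j) = (fun r => r j) ∘ Prod.snd from rfl,
        ← Measure.map_map hj measurable_snd, hM, Measure.map_snd_prod]
      simp
    rw [Measure.map_map hj (measurable_exchange p), Measure.map_map hj hmeas2, ← e1, ← e2]
    -- For `j = p` the two marginals trade places, and only their sum is preserved; for `j ≠ p` each
    -- one is unchanged.
    by_cases hjp : j = p
    · subst hjp
      rw [add_comm]
      congr 3 <;> ext q <;> simp [exchange]
    · congr 3 <;> ext q <;> simp [exchange, hjp]
  have iQ : IsProbabilityMeasure Q := HasDensity.isProbabilityMeasure p hP.1.2.2 hQ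
  have hle := hP.cost_le hQ
  have hc : Measurable (rieszEnergy s : Config N d → ℝ≥0∞) := measurable_rieszEnergy s
  have hcostQ : cost s Q = cost s P0 + ε * ∫⁻ q, (rieszEnergy s (exchange p q) +
      rieszEnergy s (exchange p q.swap)) ∂M := by
    rw [lintegral_add_left (f := fun q => rieszEnergy s (exchange p q))
      (hc.comp (measurable_exchange p)), mul_add]
    unfold cost
    rw [hQdef, lintegral_add_measure, lintegral_add_measure, lintegral_smul_measure,
      lintegral_smul_measure, lintegral_map hc (measurable_exchange p), lintegral_map hc hmeas2]
    rfl
  have hcostP : cost s P = cost s P0 + ε * ∫⁻ q, (rieszEnergy s q.1 + rieszEnergy s q.2) ∂M := by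
    rw [lintegral_add_left (f := fun q : Config N d × Config N d => rieszEnergy s q.1)
      (hc.comp measurable_fst), mul_add]
    have e1 : ∫⁻ q, rieszEnergy s q.1 ∂M = ∫⁻ r, rieszEnergy s r ∂PA := by
      rw [← lintegral_map hc measurable_fst, hM, Measure.map_fst_prod]; simp
    have e2 : ∫⁻ q, rieszEnergy s q.2 ∂M = ∫⁻ r, rieszEnergy s r ∂PB := by
      rw [← lintegral_map hc measurable_snd, hM, Measure.map_snd_prod]; simp
    rw [e1, e2]
    unfold cost
    conv_lhs => rw [← hsum]
    simp only [lintegral_add_measure, lintegral_smul_measure, smul_eq_mul, hPAdef, hPBdef]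
  have hae : ∀ᵐ q ∂M, q.1 ∈ A ∧ q.2 ∈ B := by
    have hA' : ∀ᵐ r ∂PA, r ∈ A := Measure.ae_smul_measure (ae_restrict_mem hA) _
    have hB' : ∀ᵐ r ∂PB, r ∈ B := Measure.ae_smul_measure (ae_restrict_mem hB) _
    exact (Measure.quasiMeasurePreserving_fst.ae hA').and
      (Measure.quasiMeasurePreserving_snd.ae hB')
  have hint : ∫⁻ q, (rieszEnergy s (exchange p q) + rieszEnergy s (exchange p q.swap)) ∂M + η ≤
      ∫⁻ q, (rieszEnergy s q.1 + rieszEnergy s q.2) ∂M := by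
    have : η = ∫⁻ _, η ∂M := by simp
    nth_rewrite 1 [this]
    rw [← lintegral_add_right _ measurable_const]
    exact lintegral_mono_ae (hae.mono fun q hq => h q.1 hq.1 q.2 hq.2)
  have hfinal : cost s P + ε * η ≤ cost s P := by
    calc cost s P + ε * η ≤ cost s Q + ε * η := by gcongr
      _ ≤ cost s P := by
        rw [hcostQ, hcostP, add_assoc, ← mul_add]
        gcongr
  exact absurd hfinal (not_le.2 (ENNReal.lt_add_right hfin (mul_ne_zero hε0 hη)))

/-! ### Finiteness of the minimal cost. -/

/-- A distribution function is right-continuous, and its jump at `x` is the mass of the atom at `x`.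
-/
theorem continuous_cdf_of_noAtoms (ν : Measure ℝ) [IsProbabilityMeasure ν]
    (hν : ∀ x, ν {x} = 0) : Continuous (ProbabilityTheory.cdf ν) := by
  refine continuous_iff_continuousAt.2 fun x => ?_
  rw [(ProbabilityTheory.monotone_cdf ν).continuousAt_iff_leftLim_eq_rightLim,
    StieltjesFunction.rightLim_eq]
  have h := StieltjesFunction.measure_singleton (ProbabilityTheory.cdf ν) x
  rw [ProbabilityTheory.measure_cdf, hν, eq_comm, ENNReal.ofReal_eq_zero] at h
  exact le_antisymm ((ProbabilityTheory.monotone_cdf ν).leftLim_le le_rfl) (by linarith)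

/-- A law on the line without atoms attains every quantile. -/
theorem exists_measure_Iic_eq (ν : Measure ℝ) [IsProbabilityMeasure ν]
    (hν : ∀ x, ν {x} = 0) {t : ℝ} (h0 : 0 < t) (h1 : t < 1) :
    ∃ q, ν (Set.Iic q) = ENNReal.ofReal t := by
  have hc := continuous_cdf_of_noAtoms ν hν
  obtain ⟨a, ha⟩ :=
    ((ProbabilityTheory.tendsto_cdf_atBot ν).eventually_le_const h0).exists
  obtain ⟨b, hb⟩ :=
    ((ProbabilityTheory.tendsto_cdf_atTop ν).eventually_const_le h1).exists
  obtain ⟨q, hq⟩ := mem_range_of_exists_le_of_exists_ge hc ⟨a, ha⟩ ⟨b, hb⟩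
  exact ⟨q, by rw [← ProbabilityTheory.ofReal_cdf, hq]⟩

/-- An increasing family of half-spaces of masses `0, 1/m, …, 1`, with gaps between them. -/
theorem exists_layers {X : Type*} [PseudoMetricSpace X] [MeasurableSpace X] (μ : Measure X)
    [IsProbabilityMeasure μ] {f : X → ℝ} (hf : Measurable f) (hf1 : LipschitzWith 1 f)
    (hμ : ∀ x, μ (f ⁻¹' {x}) = 0) {m : ℕ} (hm : 0 < m) :
    ∃ (T : ℕ → Set X) (α : ℝ), 0 < α ∧ T 0 = ∅ ∧ T m = Set.univ ∧
      (∀ k, MeasurableSet (T k)) ∧ (∀ k l, k ≤ l → T k ⊆ T l) ∧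
      (∀ k ≤ m, μ (T k) = ENNReal.ofReal (k / m)) ∧
      ∀ k l, k < l → ∀ x ∈ T k, ∀ y ∉ T l, α ≤ dist x y := by
  have hm' : (0 : ℝ) < m := by exact_mod_cast hm
  set ν := μ.map f with hν
  have iν : IsProbabilityMeasure ν := Measure.isProbabilityMeasure_map hf.aemeasurable
  have hν0 : ∀ x, ν {x} = 0 := fun x => by
    rw [hν, Measure.map_apply hf (measurableSet_singleton x)]; exact hμ x
  -- The levels `0` and `1` may have no finite quantile; the sets `∅` and `Set.univ` replace them
  -- below.
  have hex : ∀ k : ℕ, ∃ q, 0 < k → k < m → ν (Set.Iic q) = ENNReal.ofReal (k / m) := by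
    intro k
    by_cases hk : 0 < k ∧ k < m
    · obtain ⟨q, hq⟩ := exists_measure_Iic_eq ν hν0 (t := k / m)
        (div_pos (by exact_mod_cast hk.1) hm')
        ((div_lt_one hm').2 (by exact_mod_cast hk.2))
      exact ⟨q, fun _ _ => hq⟩
    · exact ⟨0, fun h1 h2 => absurd ⟨h1, h2⟩ hk⟩
  choose q hq using hex
  have hqlt : ∀ k l, 0 < k → k < l → l < m → q k < q l := by
    intro k l h0 hkl hl
    by_contra hle
    have h1 : ν (Set.Iic (q l)) ≤ ν (Set.Iic (q k)) :=
      measure_mono (Set.Iic_subset_Iic.2 (not_lt.1 hle))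
    rw [hq k h0 (hkl.trans hl), hq l (h0.trans hkl) hl,
      ENNReal.ofReal_le_ofReal_iff (by positivity), div_le_div_iff_of_pos_right hm'] at h1
    exact absurd hkl (not_lt.2 (by exact_mod_cast h1))
  -- Quantiles of different levels are distinct and there are finitely many of them, so one `α`
  -- bounds all gaps; the Lipschitz bound on `f` carries it over to distances.
  obtain ⟨α, hα, hgap⟩ : ∃ α : ℝ, 0 < α ∧ ∀ k ∈ Finset.range m, ∀ l ∈ Finset.range m,
      0 < k → k < l → α ≤ q l - q k := by
    have : ∀ᶠ α in nhdsWithin (0 : ℝ) (Set.Ioi 0), ∀ k ∈ Finset.range m, ∀ l ∈ Finset.range m,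
        0 < k → k < l → α ≤ q l - q k := by
      refine (Filter.eventually_all_finset _).2 fun k _ =>
        (Filter.eventually_all_finset _).2 fun l hl => ?_
      by_cases h : 0 < k ∧ k < l
      · have hpos : 0 < q l - q k := sub_pos.2 (hqlt k l h.1 h.2 (Finset.mem_range.1 hl))
        filter_upwards [Ioo_mem_nhdsGT hpos] with α hα _ _ using hα.2.le
      · exact Filter.Eventually.of_forall fun α h1 h2 => absurd ⟨h1, h2⟩ h
    obtain ⟨α, h1, h2⟩ := 
      (Filter.Eventually.and (self_mem_nhdsWithin : Set.Ioi (0 : ℝ) ∈ nhdsWithin 0 (Set.Ioi 0))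
        this).exists
    exact ⟨α, h1, h2⟩
  refine ⟨fun k => if k = 0 then ∅ else if k < m then f ⁻¹' Set.Iic (q k) else Set.univ, α, hα,
    by simp, by simp [hm.ne'], fun k => ?_, fun k l hkl => ?_, fun k hk => ?_,
    fun k l hkl x hx y hy => ?_⟩
  · beta_reduce
    split_ifs
    · exact MeasurableSet.empty
    · exact hf measurableSet_Iic
    · exact MeasurableSet.univ
  · rcases hkl.eq_or_lt with rfl | hkl
    · exact le_rfl
    · by_cases hk : k = 0
      · simp [hk]
      · by_cases hl : l < m
        · simp only [hk, hl, hkl.trans hl, if_true, if_false, (Nat.zero_lt_of_lt hkl).ne']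
          exact Set.preimage_mono (Set.Iic_subset_Iic.2 (hqlt k l (Nat.pos_of_ne_zero hk) hkl hl).le)
        · simp [hl, (Nat.zero_lt_of_lt hkl).ne']
  · beta_reduce
    split_ifs with h0 h1
    · simp [h0]
    · rw [← hq k (Nat.pos_of_ne_zero h0) h1, hν, Measure.map_apply hf measurableSet_Iic]
    · have : k = m := le_antisymm hk (not_lt.1 h1)
      subst this
      rw [div_self hm'.ne']; simp
  · have hl0 : l ≠ 0 := (Nat.zero_lt_of_lt hkl).ne'
    by_cases hk : k = 0
    · simp [hk] at hx
    by_cases hl : l < m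
    · simp only [hk, hl, hkl.trans hl, hl0, if_true, if_false, Set.mem_preimage, Set.mem_Iic,
        not_le] at hx hy
      have h1 := hgap k (Finset.mem_range.2 (hkl.trans hl)) l (Finset.mem_range.2 hl)
        (Nat.pos_of_ne_zero hk) hkl
      have h2 := hf1.dist_le_mul x y
      rw [Real.dist_eq, abs_sub_comm] at h2
      have h3 := le_abs_self (f y - f x)
      simp only [NNReal.coe_one, one_mul] at h2
      linarith
    · simp [hl, hl0] at hy

theorem volume_coord_eq_zero (i : Fin d) (c : ℝ) :
    (volume : Measure (Space d)) ((fun x : Space d => x i) ⁻¹' {c}) = 0 := by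
  have h := (PiLp.volume_preserving_ofLp (Fin d)).quasiMeasurePreserving.preimage_null
    (Measure.pi_hyperplane (fun _ : Fin d => (volume : Measure ℝ)) i c)
  exact h

theorem rieszEnergy_le_of_separated {s : ℝ} (hs : 0 < s) {α : ℝ} {r : Config N d}
    (h : ∀ i j, i ≠ j → α ≤ dist (r i) (r j)) :
    rieszEnergy s r ≤ N * (N * (1 / ENNReal.ofReal α ^ s)) := by
  have hterm : ∀ i j, i ≠ j → 1 / ‖r i - r j‖ₑ ^ s ≤ 1 / ENNReal.ofReal α ^ s := by
    intro i j hij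
    refine ENNReal.div_le_div_left (ENNReal.rpow_le_rpow ?_ hs.le) 1
    rw [← ofReal_norm, ← dist_eq_norm]
    exact ENNReal.ofReal_le_ofReal (h i j hij)
  calc rieszEnergy s r ≤ ∑ i : Fin N, ∑ j : Fin N, 1 / ENNReal.ofReal α ^ s := by
        refine Finset.sum_le_sum fun i _ => ?_
        calc ∑ j ∈ Finset.Ioi i, 1 / ‖r i - r j‖ₑ ^ s
            ≤ ∑ j ∈ Finset.Ioi i, 1 / ENNReal.ofReal α ^ s :=
              Finset.sum_le_sum fun j hj => hterm i j (Finset.mem_Ioi.1 hj).ne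
          _ ≤ _ := Finset.sum_le_sum_of_subset (Finset.subset_univ _)
    _ = _ := by simp

/-- A law charging no level set of a coordinate is the common marginal of a separated plan. -/
theorem exists_separated_plan (hN : 0 < N) (μ : Measure (Space d)) [IsProbabilityMeasure μ]
    (i₀ : Fin d) (hμ : ∀ c, μ ((fun x : Space d => x i₀) ⁻¹' {c}) = 0) :
    ∃ (Q : Measure (Config N d)) (α : ℝ), 0 < α ∧
      (∀ i, Q.map (fun r : Config N d => r i) = μ) ∧
      ∀ᵐ r ∂Q, ∀ i j, i ≠ j → α ≤ dist (r i) (r j) := by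
  have hL : LipschitzWith 1 fun x : Space d => x i₀ := by
    refine LipschitzWith.of_dist_le_mul fun x y => ?_
    simp only [NNReal.coe_one, one_mul, dist_eq_norm]
    exact PiLp.norm_apply_le (x - y) i₀
  obtain ⟨T, α, hα, hT0, hTm, hTmeas, hTmono, hTμ, hgap⟩ :=
    -- Twice as many slabs as particles: when all particles sit in slabs of one parity, an unused
    -- slab separates any two of them.
    exists_layers μ hL.continuous.measurable hL hμ (m := 2 * N) (by omega)
  have hne : NeZero N := ⟨hN.ne'⟩
  set M : ℝ≥0∞ := ((2 * N : ℕ) : ℝ≥0∞) with hM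
  have hM0 : M ≠ 0 := by simp [hM, hN.ne']
  have hM1 : M ≠ ∞ := ENNReal.natCast_ne_top _
  set S : ℕ → Set (Space d) := fun k => T (k + 1) \ T k with hS
  have hSmeas : ∀ k, MeasurableSet (S k) := fun k => (hTmeas _).diff (hTmeas _)
  have hSμ : ∀ k < 2 * N, μ (S k) = M⁻¹ := by
    intro k hk
    rw [hS, measure_sdiff (hTmono _ _ (Nat.le_succ k)) (hTmeas k).nullMeasurableSet
      (measure_ne_top _ _), hTμ _ hk, hTμ _ hk.le, ← ENNReal.ofReal_sub _ (by positivity),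
      ← sub_div, hM, ← ENNReal.ofReal_natCast, ← ENNReal.ofReal_inv_of_pos (by positivity)]
    congr 1
    push_cast
    ring
  have hSsum : ∀ n, ∑ k ∈ Finset.range n, μ.restrict (S k) = μ.restrict (T n) := by
    intro n
    induction n with
    | zero => simp [hT0]
    | succ n ih =>
      rw [Finset.sum_range_succ, ih, ← Measure.restrict_union Set.disjoint_sdiff_right (hSmeas n),
        Set.union_sdiff_cancel (hTmono _ _ (Nat.le_succ n))]
  have hSgap : ∀ k l, k + 2 ≤ l → ∀ x ∈ S k, ∀ y ∈ S l, α ≤ dist x y := fun k l hkl x hx y hy =>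
    hgap (k + 1) l (by omega) x hx.1 y hy.2
  -- the slab of particle `i` in the plan with parameters `k`, `e`
  set lab : Fin N → ℕ → Fin N → ℕ := fun k e i => 2 * ((i + k : Fin N) : ℕ) + e with hlab
  set ν : Fin N → ℕ → Fin N → Measure (Space d) :=
    fun k e i => M • μ.restrict (S (lab k e i)) with hν
  have hlablt : ∀ k, ∀ e ∈ Finset.range 2, ∀ i, lab k e i < 2 * N := by
    intro k e he i
    have h1 := (i + k).isLt
    have h2 := Finset.mem_range.1 he
    simp only [hlab]
    omega
  have hνp : ∀ k, ∀ e ∈ Finset.range 2, ∀ i, IsProbabilityMeasure (ν k e i) := by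
    intro k e he i
    constructor
    simp only [hν, Measure.smul_apply, Measure.restrict_apply_univ, smul_eq_mul]
    rw [hSμ _ (hlablt k e he i), ENNReal.mul_inv_cancel hM0 hM1]
  have hνf : ∀ k e i, IsFiniteMeasure (ν k e i) := fun k e i => Measure.smul_finite _ hM1
  -- An equal mixture of `2 * N` product plans, one for each parity `e` and cyclic shift `k`; over
  -- these, every particle visits every slab exactly once, which gives the marginal `μ`.
  refine ⟨∑ e ∈ Finset.range 2, ∑ k, M⁻¹ • Measure.pi (ν k e), α, hα, fun i => ?_, ?_⟩
  · have hi := measurable_pi_apply (X := fun _ : Fin N => Space d) i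
    rw [map_finset_sum _ _ hi]
    have h1 : ∀ e ∈ Finset.range 2,
        (∑ k, M⁻¹ • Measure.pi (ν k e)).map (fun r : Config N d => r i) =
          ∑ k ∈ Finset.range N, μ.restrict (S (2 * k + e)) := by
      intro e he
      rw [map_finset_sum _ _ hi, ← Fin.sum_univ_eq_sum_range (fun k => μ.restrict (S (2 * k + e)))]
      refine Eq.trans (Finset.sum_congr rfl fun k _ => ?_) (Equiv.sum_comp (Equiv.addLeft i) _)
      have := hνp k e he
      rw [Measure.map_smul]
      have h2 : (Measure.pi (ν k e)).map (fun r : Config N d => r i) = ν k e i :=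
        (measurePreserving_eval (ν k e) i).map_eq
      rw [h2, hν, smul_smul, ENNReal.inv_mul_cancel hM0 hM1, one_smul]
      rfl
    rw [Finset.sum_congr rfl h1, Finset.sum_comm]
    have h3 : ∀ n, ∑ k ∈ Finset.range n, ∑ e ∈ Finset.range 2, μ.restrict (S (2 * k + e)) =
        ∑ k ∈ Finset.range (2 * n), μ.restrict (S k) := by
      intro n
      induction n with
      | zero => simp
      | succ n ih =>
        rw [Finset.sum_range_succ, ih, show 2 * (n + 1) = 2 * n + 1 + 1 by ring,
          Finset.sum_range_succ _ (2 * n + 1), Finset.sum_range_succ _ (2 * n),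
          Finset.sum_range_succ, Finset.sum_range_one, add_assoc, add_zero]
    rw [h3, hSsum, hTm, Measure.restrict_univ]
  · rw [ae_iff, Measure.finsetSum_apply, Finset.sum_eq_zero]
    intro e he
    rw [Measure.finsetSum_apply, Finset.sum_eq_zero]
    intro k _
    rw [Measure.smul_apply, smul_eq_mul, mul_eq_zero]
    right
    rw [← ae_iff]
    have := hνp k e he
    have hmem : ∀ᵐ r ∂Measure.pi (ν k e), ∀ i, r i ∈ S (lab k e i) := by
      refine ae_all_iff.2 fun i => ?_
      have h4 : ∀ᵐ x ∂ν k e i, x ∈ S (lab k e i) :=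
        Measure.ae_smul_measure (ae_restrict_mem (hSmeas _)) _
      exact (measurePreserving_eval (ν k e) i).quasiMeasurePreserving.ae h4
    refine hmem.mono fun r hr i j hij => ?_
    have hne : ((i + k : Fin N) : ℕ) ≠ ((j + k : Fin N) : ℕ) := fun h =>
      hij (add_right_cancel (Fin.ext h))
    rcases lt_or_gt_of_ne hne with h | h
    · exact hSgap _ _ (by simp only [hlab]; omega) _ (hr i) _ (hr j)
    · rw [dist_comm]
      exact hSgap _ _ (by simp only [hlab]; omega) _ (hr j) _ (hr i)

/-- In positive dimension, the minimal cost is finite. -/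
theorem IsSymmetricMinimizer.cost_ne_top (hN : 0 < N) (i₀ : Fin d) {s : ℝ} (hs : 0 < s)
    {ρ : Space d → ℝ} {P : Measure (Config N d)} (hP : IsSymmetricMinimizer s ρ P) :
    cost s P ≠ ∞ := by
  have hprob : IsProbabilityMeasure P := hP.1.1
  set μ := (volume : Measure (Space d)).withDensity fun x => ENNReal.ofReal (ρ x / (N : ℝ)) with hμ
  have hi := measurable_pi_apply (X := fun _ : Fin N => Space d) ⟨0, hN⟩
  have iμ : IsProbabilityMeasure μ := by
    have h := hP.1.2.2 ⟨0, hN⟩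
    rw [hμ, ← h]
    exact Measure.isProbabilityMeasure_map hi.aemeasurable
  -- Absolute continuity of the marginal enters here: coordinate hyperplanes are null.
  obtain ⟨Q, α, hα, hQ, hsep⟩ := exists_separated_plan hN μ i₀ fun c =>
    withDensity_absolutelyContinuous _ _ (volume_coord_eq_zero i₀ c)
  have hQ' : HasDensity Q ρ := hQ
  have iQ : IsProbabilityMeasure Q := HasDensity.isProbabilityMeasure ⟨0, hN⟩ hP.1.2.2 hQ'
  refine ne_top_of_le_ne_top ?_ ((hP.cost_le hQ').trans
    (lintegral_mono_ae (hsep.mono fun r hr => rieszEnergy_le_of_separated hs hr)))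
  rw [lintegral_const, measure_univ, mul_one]
  refine ENNReal.mul_ne_top (by simp) (ENNReal.mul_ne_top (by simp) ?_)
  refine ENNReal.div_ne_top (by simp) ?_
  simp [hα, ENNReal.rpow_eq_zero_iff]

/-! ### The energy gained by exchanging far particles. -/

theorem one_div_enorm_rpow_le {s : ℝ} (hs : 0 < s) {x : Space d} {c : ℝ} (hc : 0 < c)
    (h : c ≤ ‖x‖) : 1 / ‖x‖ₑ ^ s ≤ ENNReal.ofReal (1 / c ^ s) := by
  rw [ENNReal.ofReal_div_of_pos (Real.rpow_pos_of_pos hc s), ← ENNReal.ofReal_rpow_of_pos hc,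
    ENNReal.ofReal_one, ← ofReal_norm]
  gcongr

theorem le_one_div_enorm_rpow {s : ℝ} (hs : 0 < s) {x : Space d} {c : ℝ} (hc : 0 < c)
    (h : ‖x‖ ≤ c) : ENNReal.ofReal (1 / c ^ s) ≤ 1 / ‖x‖ₑ ^ s := by
  rw [ENNReal.ofReal_div_of_pos (Real.rpow_pos_of_pos hc s), ← ENNReal.ofReal_rpow_of_pos hc,
    ENNReal.ofReal_one, ← ofReal_norm]
  gcongr

/-- Translations do not affect the interaction at infinity, to leading order. -/
theorem eventually_one_div_sub_rpow_le (s : ℝ) (c : ℝ) {δ : ℝ} (hδ : 0 < δ) :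
    ∀ᶠ t : ℝ in Filter.atTop, 1 / (t - c) ^ s ≤ 1 / (t + c) ^ s + δ / t ^ s := by
  have hlim : Filter.Tendsto (fun t : ℝ => 1 / (1 - c / t) ^ s - 1 / (1 + c / t) ^ s)
      Filter.atTop (nhds 0) := by
    have h0 : Filter.Tendsto (fun t : ℝ => c / t) Filter.atTop (nhds 0) :=
      Filter.Tendsto.const_div_atTop Filter.tendsto_id c
    have h1 : Filter.Tendsto (fun t : ℝ => 1 / (1 - c / t) ^ s) Filter.atTop (nhds 1) := by
      have := ((tendsto_const_nhds (x := (1 : ℝ))).sub h0).rpow_const (p := s) (by simp)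
      simpa using this.inv₀ (by simp)
    have h2 : Filter.Tendsto (fun t : ℝ => 1 / (1 + c / t) ^ s) Filter.atTop (nhds 1) := by
      have := ((tendsto_const_nhds (x := (1 : ℝ))).add h0).rpow_const (p := s) (by simp)
      simpa using this.inv₀ (by simp)
    simpa using h1.sub h2
  filter_upwards [hlim.eventually_le_const hδ, Filter.eventually_gt_atTop |c|] with t ht hct
  have ht0 : 0 < t := (abs_nonneg c).trans_lt hct
  have hc1 := abs_lt.1 hct
  have e1 : t - c = t * (1 - c / t) := by field_simp
  have e2 : t + c = t * (1 + c / t) := by field_simp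
  have p1 : 0 ≤ 1 - c / t := by
    rw [sub_nonneg, div_le_one ht0]; exact hc1.2.le
  have p2 : 0 ≤ 1 + c / t := by
    have : -1 ≤ c / t := by rw [le_div_iff₀ ht0]; linarith
    linarith
  rw [e1, e2, Real.mul_rpow ht0.le p1, Real.mul_rpow ht0.le p2]
  have hts : 0 < t ^ s := Real.rpow_pos_of_pos ht0 s
  calc 1 / (t ^ s * (1 - c / t) ^ s) = 1 / (1 - c / t) ^ s / t ^ s := by
        rw [div_div, mul_comm]
    _ ≤ (1 / (1 + c / t) ^ s + δ) / t ^ s := by gcongr; linarith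
    _ = 1 / (t ^ s * (1 + c / t) ^ s) + δ / t ^ s := by rw [add_div, div_div, mul_comm (t ^ s)]

/-- Exchanging the outermost particle of a configuration `a` having two particles far out with a
particle that is even farther out lowers the energy. -/
theorem exchange_energy_lt {s : ℝ} (hs : 0 < s) {K : Finset (Fin N)} {p k : Fin N}
    (hk : k ∈ K) (hkp : k ≠ p) (hp : p ∈ K) {c T D : ℝ} (hc : 0 < c) (hD : 0 < D)
    (hDT : 2 / D ^ s ≤ 1 / (2 * T) ^ s / (4 * N)) {a b : Config N d}
    (hca : c < ‖a p‖) (haT : ‖a p‖ ≤ T)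
    (hR : 1 / (‖a p‖ - c) ^ s ≤ 1 / (‖a p‖ + c) ^ s + 1 / 2 ^ s / (4 * N) / ‖a p‖ ^ s)
    (haK : ∀ j ∈ K, ‖a j‖ ≤ ‖a p‖) (haC : ∀ j ∉ K, ‖a j‖ < c)
    (hbK : ∀ j ∈ K, T + D ≤ ‖b j‖) (hbC : ∀ j ∉ K, ‖b j‖ < c) :
    rieszEnergy s (exchange p (a, b)) + rieszEnergy s (exchange p (b, a)) +
      ENNReal.ofReal (1 / (2 * T) ^ s / 2) ≤ rieszEnergy s a + rieszEnergy s b := by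
  have hN : (0 : ℝ) < N := by exact_mod_cast p.pos
  set t := ‖a p‖ with ht
  have ht0 : 0 < t := hc.trans hca
  have hT0 : 0 < T := ht0.trans_le haT
  -- A lower bound for the repulsion between `a p` and `a k`, both of norm at most `t`. All errors
  -- are measured against `g`.
  set g := 1 / (2 * t) ^ s with hg
  have hg0 : 0 < g := by positivity
  have hgT : 1 / (2 * T) ^ s ≤ g := by rw [hg]; gcongr
  have hgδ : 1 / 2 ^ s / (4 * N) / t ^ s = g / (4 * N) := by
    rw [hg, Real.mul_rpow zero_le_two ht0.le]; field_simp
  rw [hgδ] at hR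
  have hDg : 2 / D ^ s ≤ g / (4 * N) := hDT.trans (by gcongr)
  have hDs : 0 < D ^ s := Real.rpow_pos_of_pos hD s
  have hD1 : 1 / D ^ s ≤ 2 / D ^ s := by gcongr; norm_num
  have haT' : ∀ j, ‖a j‖ ≤ T := by
    intro j
    by_cases hj : j ∈ K
    · exact (haK j hj).trans haT
    · exact ((haC j hj).le.trans hca.le).trans haT
  have hfar : ∀ i j, i ∈ K → 1 / ‖b i - a j‖ₑ ^ s ≤ ENNReal.ofReal (1 / D ^ s) := by
    intro i j hi
    refine one_div_enorm_rpow_le hs hD ?_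
    linarith [norm_sub_norm_le (b i) (a j), hbK i hi, haT' j]
  -- For `j ∈ K` both new distances are at least `D`. For `j ∉ K` the old term `1 / ‖a p - a j‖ₑ ^
  -- s` pays for the new term with `b j`, since `a j` and `b j` lie in the same ball. The errors add
  -- up to at most `g / 2`.
  have hterm : ∀ j ∈ Finset.univ.erase p, 1 / ‖b p - a j‖ₑ ^ s + 1 / ‖a p - b j‖ₑ ^ s ≤
      (if j ∈ K then 0 else 1 / ‖a p - a j‖ₑ ^ s) + ENNReal.ofReal (g / (2 * N)) := by
    intro j _
    have hε : g / (2 * N) = g / (4 * N) + g / (4 * N) := by ring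
    split_ifs with hj
    · have h1 : 1 / ‖a p - b j‖ₑ ^ s ≤ ENNReal.ofReal (1 / D ^ s) := by
        rw [← enorm_neg, neg_sub]; exact hfar j p hj
      rw [zero_add]
      refine (add_le_add (hfar p j hp) h1).trans ?_
      rw [← ENNReal.ofReal_add (by positivity) (by positivity)]
      refine ENNReal.ofReal_le_ofReal ?_
      rw [hε]
      linarith
    · have h1 : 1 / ‖a p - b j‖ₑ ^ s ≤ ENNReal.ofReal (1 / (t - c) ^ s) := by
        refine one_div_enorm_rpow_le hs (sub_pos.2 hca) ?_
        linarith [norm_sub_norm_le (a p) (b j), hbC j hj]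
      have h2 : ENNReal.ofReal (1 / (t + c) ^ s) ≤ 1 / ‖a p - a j‖ₑ ^ s := by
        refine le_one_div_enorm_rpow hs (by positivity) ?_
        linarith [norm_sub_le (a p) (a j), haC j hj]
      calc 1 / ‖b p - a j‖ₑ ^ s + 1 / ‖a p - b j‖ₑ ^ s
          ≤ ENNReal.ofReal (1 / D ^ s) + ENNReal.ofReal (1 / (t - c) ^ s) :=
            add_le_add (hfar p j hp) h1
        _ ≤ ENNReal.ofReal (g / (4 * N)) +
            ENNReal.ofReal (1 / (t + c) ^ s + g / (4 * N)) := by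
            exact add_le_add (ENNReal.ofReal_le_ofReal (hD1.trans hDg))
              (ENNReal.ofReal_le_ofReal hR)
        _ = ENNReal.ofReal (1 / (t + c) ^ s) + ENNReal.ofReal (g / (2 * N)) := by
            rw [hε, ENNReal.ofReal_add (by positivity) (by positivity),
              ENNReal.ofReal_add (by positivity) (by positivity)]
            ring
        _ ≤ _ := by gcongr
  have hsum : ∑ j ∈ Finset.univ.erase p, 1 / ‖b p - a j‖ₑ ^ s +
      ∑ j ∈ Finset.univ.erase p, 1 / ‖a p - b j‖ₑ ^ s + ENNReal.ofReal (1 / (2 * T) ^ s / 2) ≤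
      ∑ j ∈ Finset.univ.erase p, 1 / ‖a p - a j‖ₑ ^ s := by
    have hcard : ∑ j ∈ Finset.univ.erase p, ENNReal.ofReal (g / (2 * N)) ≤
        ENNReal.ofReal (g / 2) := by
      calc ∑ j ∈ Finset.univ.erase p, ENNReal.ofReal (g / (2 * N))
          ≤ ∑ j : Fin N, ENNReal.ofReal (g / (2 * N)) :=
            Finset.sum_le_sum_of_subset (Finset.erase_subset _ _)
        _ = ENNReal.ofReal (g / 2) := by
            rw [Finset.sum_const, Finset.card_univ, Fintype.card_fin, nsmul_eq_mul,
              ← ENNReal.ofReal_natCast, ← ENNReal.ofReal_mul hN.le]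
            congr 1
            field_simp
    have hkm : k ∈ Finset.univ.erase p := Finset.mem_erase.2 ⟨hkp, Finset.mem_univ k⟩
    have hnear : ENNReal.ofReal g ≤ 1 / ‖a p - a k‖ₑ ^ s := by
      refine le_one_div_enorm_rpow hs (by positivity) ?_
      linarith [norm_sub_le (a p) (a k), haK k hk]
    rw [← Finset.sum_add_distrib]
    calc _ ≤ ∑ j ∈ Finset.univ.erase p, ((if j ∈ K then 0 else 1 / ‖a p - a j‖ₑ ^ s) +
            ENNReal.ofReal (g / (2 * N))) + ENNReal.ofReal (g / 2) := by
          exact add_le_add (Finset.sum_le_sum hterm) (ENNReal.ofReal_le_ofReal (by linarith))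
      _ ≤ ∑ j ∈ Finset.univ.erase p, (if j ∈ K then 0 else 1 / ‖a p - a j‖ₑ ^ s) +
            ENNReal.ofReal (g / 2) + ENNReal.ofReal (g / 2) := by
          rw [Finset.sum_add_distrib]
          gcongr
      _ = ∑ j ∈ Finset.univ.erase p, (if j ∈ K then 0 else 1 / ‖a p - a j‖ₑ ^ s) +
            ENNReal.ofReal g := by
          rw [add_assoc, ← ENNReal.ofReal_add (by positivity) (by positivity), add_halves]
      _ ≤ _ := by
          -- The old interaction with `k ∈ K` has not been spent: half of its bound `g` absorbs the
          -- errors, the other half is the gain.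
          rw [← Finset.add_sum_erase _ _ hkm, ← Finset.add_sum_erase _ _ hkm, if_pos hk, zero_add,
            add_comm]
          refine add_le_add hnear (Finset.sum_le_sum fun j _ => ?_)
          split_ifs
          · exact zero_le
          · exact le_rfl
  have hex : ∀ u v : Config N d, rieszEnergy s (exchange p (u, v)) =
      restEnergy s p u + ∑ j ∈ Finset.univ.erase p, 1 / ‖v p - u j‖ₑ ^ s := by
    intro u v
    rw [rieszEnergy_eq_restEnergy_add s p]
    unfold exchange
    rw [restEnergy_update]
    congr 1
    refine Finset.sum_congr rfl fun j hj => ?_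
    rw [Function.update_self, Function.update_of_ne (Finset.ne_of_mem_erase hj)]
  rw [hex, hex, rieszEnergy_eq_restEnergy_add s p a, rieszEnergy_eq_restEnergy_add s p b]
  calc _ = restEnergy s p a + restEnergy s p b +
        (∑ j ∈ Finset.univ.erase p, 1 / ‖b p - a j‖ₑ ^ s +
      ∑ j ∈ Finset.univ.erase p, 1 / ‖a p - b j‖ₑ ^ s + ENNReal.ofReal (1 / (2 * T) ^ s / 2)) := by
        ring
    -- The old interactions of `b p` are nonnegative and simply discarded.
    _ ≤ restEnergy s p a + restEnergy s p b +
        (∑ j ∈ Finset.univ.erase p, 1 / ‖a p - a j‖ₑ ^ s +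
          ∑ j ∈ Finset.univ.erase p, 1 / ‖b p - b j‖ₑ ^ s) := by
        exact add_le_add_right (hsum.trans le_self_add) _
    _ = _ := by ring

/-! ### Maximal sets of escaping particles and the contradiction. -/

/-- The configurations whose particles with index in `K` are at distance at least `R` from `0`. -/
def outer (K : Finset (Fin N)) (R : ℝ) : Set (Config N d) :=
  {r | ∀ i ∈ K, R ≤ ‖r i‖}

/-- The configurations in `outer K R` whose remaining particles are within distance `c` of `0`,
and whose `p`-th particle is the farthest one among those with index in `K`. -/
def outerMax (K : Finset (Fin N)) (c : ℝ) (p : Fin N) (R : ℝ) : Set (Config N d) :=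
  {r | (∀ i ∈ K, R ≤ ‖r i‖) ∧ (∀ i ∉ K, ‖r i‖ < c) ∧ ∀ i ∈ K, ‖r i‖ ≤ ‖r p‖}

theorem measurableSet_outerMax (K : Finset (Fin N)) (c : ℝ) (p : Fin N) (R : ℝ) :
    MeasurableSet (outerMax K c p R : Set (Config N d)) := by
  have hn : ∀ i : Fin N, Measurable fun r : Config N d => ‖r i‖ := fun i =>
    (measurable_pi_apply i).norm
  have h1 : MeasurableSet {r : Config N d | ∀ i ∈ K, R ≤ ‖r i‖} := by
    simp only [Set.ofPred_forall]
    exact MeasurableSet.iInter fun i => MeasurableSet.iInter fun _ =>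
      measurableSet_le measurable_const (hn i)
  have h2 : MeasurableSet {r : Config N d | ∀ i ∉ K, ‖r i‖ < c} := by
    simp only [Set.ofPred_forall]
    exact MeasurableSet.iInter fun i => MeasurableSet.iInter fun _ =>
      measurableSet_lt (hn i) measurable_const
  have h3 : MeasurableSet {r : Config N d | ∀ i ∈ K, ‖r i‖ ≤ ‖r p‖} := by
    simp only [Set.ofPred_forall]
    exact MeasurableSet.iInter fun i => MeasurableSet.iInter fun _ =>
      measurableSet_le (hn i) (hn p)
  exact h1.inter (h2.inter h3)

theorem eventually_null_of_antitone {X : Type*} [MeasurableSpace X] {P : Measure X}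
    {E : ℝ → Set X} (hE : Antitone E) (h : ¬ ∀ R, P (E R) ≠ 0) :
    ∀ᶠ R in Filter.atTop, P (E R) = 0 := by
  push Not at h
  obtain ⟨R, hR⟩ := h
  filter_upwards [Filter.eventually_ge_atTop R] with R' hR'
  exact measure_mono_null (hE hR') hR

/-- If two particles of `P` can be found arbitrarily far away together, then there is a set `K` of
at least two particles that can be found arbitrarily far away together, the `p`-th one being the
farthest, while the other particles remain in a fixed ball. -/
theorem exists_outerMax_ne_zero (P : Measure (Config N d))
    (h : ∀ R : ℝ, 0 < R → ∃ i j : Fin N, i ≠ j ∧ P (outer {i, j} R) ≠ 0) :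
    ∃ (K : Finset (Fin N)) (p : Fin N) (c : ℝ), 0 < c ∧ p ∈ K ∧ (∃ k ∈ K, k ≠ p) ∧
      ∀ R, P (outerMax K c p R) ≠ 0 := by
  have hanti : ∀ K : Finset (Fin N), Antitone (outer K : ℝ → Set (Config N d)) :=
    fun K R R' hR r hr i hi => hR.trans (hr i hi)
  obtain ⟨i, j, hij, hgood⟩ : ∃ i j : Fin N, i ≠ j ∧ ∀ R, P (outer {i, j} R) ≠ 0 := by
    by_contra! hcon
    have hev : ∀ᶠ R : ℝ in Filter.atTop, ∀ i j : Fin N, i ≠ j → P (outer {i, j} R) = 0 := by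
      refine Filter.eventually_all.2 fun i => Filter.eventually_all.2 fun j =>
        Filter.eventually_imp_distrib_left.2 fun hij => ?_
      exact eventually_null_of_antitone (hanti _) (by push Not; exact hcon i j hij)
    obtain ⟨R, hR, hR0⟩ := (hev.and (Filter.eventually_gt_atTop 0)).exists
    obtain ⟨i, j, hij, hne⟩ := h R hR0
    exact hne (hR i j hij)
  obtain ⟨K, hijK, hK⟩ := (Set.toFinite {K : Finset (Fin N) | ∀ R, P (outer K R) ≠ 0}
    ).exists_le_maximal hgood
  -- By maximality of `K`, no further particle can escape along with it; finitely many `l` allow a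
  -- common radius `c`.
  have hmax : ∀ᶠ c : ℝ in Filter.atTop, ∀ l, l ∉ K → P (outer (insert l K) c) = 0 := by
    refine Filter.eventually_all.2 fun l => Filter.eventually_imp_distrib_left.2 fun hl => ?_
    refine eventually_null_of_antitone (hanti _) fun hgood' => hl ?_
    exact hK.2 hgood' (Finset.subset_insert l K) (Finset.mem_insert_self l K)
  obtain ⟨c, hc, hc0⟩ := (hmax.and (Filter.eventually_gt_atTop 0)).exists
  have hiK : i ∈ K := hijK (by simp)
  have hjK : j ∈ K := hijK (by simp)
  obtain ⟨p, hp, hpR⟩ : ∃ p, p ∈ K ∧ ∀ R, P (outerMax K c p R) ≠ 0 := by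
    by_contra! hcon
    have hev : ∀ᶠ R : ℝ in Filter.atTop, ∀ p, p ∈ K → P (outerMax K c p R) = 0 := by
      refine Filter.eventually_all.2 fun p => Filter.eventually_imp_distrib_left.2 fun hp => ?_
      refine eventually_null_of_antitone (fun R R' hR r hr => ?_) (by push Not; exact hcon p hp)
      exact ⟨fun i hi => hR.trans (hr.1 i hi), hr.2⟩
    obtain ⟨R, hR, hRc⟩ := (hev.and (Filter.eventually_ge_atTop c)).exists
    -- Since `R ≥ c`, a configuration in `outer K R` either has an additional particle outside the
    -- ball of radius `c`, or lies in some `outerMax K c p R`; both families would be null.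
    refine hK.1 R (measure_mono_null (t := (⋃ l, ⋃ (_ : l ∉ K), outer (insert l K) c) ∪
      ⋃ p, ⋃ (_ : p ∈ K), outerMax K c p R) (fun r hr => ?_) ?_)
    · by_cases hl : ∃ l, l ∉ K ∧ c ≤ ‖r l‖
      · obtain ⟨l, hl, hcl⟩ := hl
        refine Or.inl (Set.mem_iUnion₂.2 ⟨l, hl, fun i hi => ?_⟩)
        rcases Finset.mem_insert.1 hi with rfl | hi
        · exact hcl
        · exact hRc.trans (hr i hi)
      · push Not at hl
        obtain ⟨p, hp, hpmax⟩ := K.exists_max_image (fun i => ‖r i‖) ⟨i, hiK⟩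
        exact Or.inr (Set.mem_iUnion₂.2 ⟨p, hp, hr, hl, hpmax⟩)
    · refine measure_union_null ?_ ?_
      · exact measure_iUnion_null fun l => measure_iUnion_null fun hl => hc l hl
      · exact measure_iUnion_null fun p => measure_iUnion_null fun hp => hR p hp
  refine ⟨K, p, c, hc0, hp, ?_, hpR⟩
  by_cases hip : i = p
  · exact ⟨j, hjK, fun h => hij (hip.trans h.symm)⟩
  · exact ⟨i, hiK, hip⟩

/-- The constants are chosen in the order `c`, `R`, `T`, `D`: the bounded particles fix `c`,
translations by `c` become negligible beyond `R`, `T` truncates the first configuration, and `D`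
puts the second one far beyond `T`. -/
theorem IsSymmetricMinimizer.exists_outer_null {s : ℝ} (hs : 0 < s) {ρ : Space d → ℝ}
    {P : Measure (Config N d)} (hP : IsSymmetricMinimizer s ρ P) (hfin : cost s P ≠ ∞) :
    ∃ R : ℝ, 0 < R ∧ ∀ i j : Fin N, i ≠ j → P (outer {i, j} R) = 0 := by
  by_contra! hcon
  obtain ⟨K, p, c, hc, hp, ⟨k, hk, hkp⟩, hne⟩ := exists_outerMax_ne_zero P hcon
  have hN : (0 : ℝ) < N := by exact_mod_cast p.pos
  obtain ⟨R, hR⟩ := Filter.eventually_atTop.1 ((eventually_one_div_sub_rpow_le s c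
    (δ := 1 / 2 ^ s / (4 * N)) (by positivity)).and (Filter.eventually_gt_atTop c))
  -- The gain decays like `‖r p‖^{-s}`; an upper bound on `‖r p‖` makes it uniform and allows a
  -- single `D`.
  obtain ⟨n, hn⟩ : ∃ n : ℕ, P (outerMax K c p R ∩ {r | ‖r p‖ ≤ n}) ≠ 0 := by
    by_contra! hzero
    refine hne R (measure_mono_null (fun r hr => ?_) (measure_iUnion_null hzero))
    obtain ⟨n, hn⟩ := exists_nat_ge ‖r p‖
    exact Set.mem_iUnion.2 ⟨n, hr, hn⟩
  set T : ℝ := (n : ℝ)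
  have hT : 0 < T := by
    obtain ⟨r, hr, hrT⟩ := nonempty_of_measure_ne_zero hn
    exact (hc.trans (hR _ (hr.1 p hp)).2).trans_le hrT
  obtain ⟨D, hDT, hD⟩ : ∃ D : ℝ, 2 / D ^ s ≤ 1 / (2 * T) ^ s / (4 * N) ∧ 0 < D := by
    have hlim : Filter.Tendsto (fun D : ℝ => 2 / D ^ s) Filter.atTop (nhds 0) :=
      (tendsto_rpow_atTop hs).const_div_atTop 2
    exact ((hlim.eventually_le_const (by positivity)).and (Filter.eventually_gt_atTop 0)).exists
  refine hP.not_exchange_lt hfin p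
    ((measurableSet_outerMax K c p R).inter
      (measurableSet_le (measurable_pi_apply p).norm measurable_const))
    (measurableSet_outerMax K c p (T + D)) hn (hne _)
    (η := ENNReal.ofReal (1 / (2 * T) ^ s / 2)) ?_ fun a ha b hb => ?_
  · exact (ENNReal.ofReal_pos.2 (by positivity)).ne'
  · have hRa := hR _ (ha.1.1 p hp)
    exact exchange_energy_lt hs hk hkp hp hc hD hDT hRa.2 ha.2 hRa.1 ha.1.2.2 ha.1.2.1 hb.1 hb.2.1

end SCE

theorem mainTheorem2 (N d : ℕ) (hN : 2 ≤ N) (s : ℝ) (hs : 0 < s)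
    (ρ : SCE.Space d → ℝ) (hρ_int : Integrable ρ volume) (hρ_nonneg : 0 ≤ᵐ[volume] ρ)
    (hρ_mass : ∫ x, ρ x = (N : ℝ))
    (P : Measure (SCE.Config N d)) (hP : SCE.IsSymmetricMinimizer s ρ P) :
    ∃ R : ℝ, 0 < R ∧ ∀ i j : Fin N, i ≠ j →
      P {r | r i ∈ (Metric.ball (0 : SCE.Space d) R)ᶜ ∧
        r j ∈ (Metric.ball (0 : SCE.Space d) R)ᶜ} = 0 := by
  rcases Nat.eq_zero_or_pos d with rfl | hd
  -- In dimension `0` all particles coincide and the cost is infinite, so the exchange argument is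
  -- not available; but the event is empty.
  · refine ⟨1, one_pos, fun i j _ => measure_mono_null (fun r hr => ?_) measure_empty⟩
    refine hr.1 ?_
    rw [Subsingleton.elim (r i) 0]
    exact Metric.mem_ball_self one_pos
  · obtain ⟨R, hR, h⟩ := hP.exists_outer_null hs (hP.cost_ne_top (by omega) ⟨0, hd⟩ hs)
    refine ⟨R, hR, fun i j hij => measure_mono_null (t := SCE.outer {i, j} R)
      (fun r hr k hk => ?_) (h i j hij)⟩
    simp only [Set.mem_ofPred_eq, Set.mem_compl_iff, mem_ball_zero_iff, not_lt] at hr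
    rcases Finset.mem_insert.1 hk with rfl | hk
    · exact hr.1
    · rw [Finset.mem_singleton.1 hk]; exact hr.2
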